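/- **Proposition 3.1.** Let $\mathfrak g$ be an affine Lie algebra over $\mathbb C$ (untwisted or twisted) with indecomposable affine generalized Cartan matrix $A=(a_{ij})_{0\le i,j\le n}$, the vertices of the Dynkin diagram being numbered as in Kac's tables Aff 1–3. Let $\alpha_i$, $\alpha_i^\vee$ $(0\le i\le n)$ be the simple roots and coroots, $a_i$ and $a_i^\vee$ the numerical labels (the coprime positive integers with $\sum_j a_{ij}a_j=0$ and $\sum_i a_i^\vee a_{ij}=0$), $\delta=\sum_i a_i\alpha_i$, $c=\sum_i a_i^\vee\alpha_i^\vee$, and $\Lambda_0$ the fundamental weight of the vertex $0$, so that $\alpha_0,\dots,\alpha_n,\Lambda_0$ is a basis of $\mathfrak h^*$. Let $\langle\,,\rangle$ be the normalized invariant form on $\mathfrak h^*$, that is, $\langle\alpha_i,\alpha_j\rangle=\frac{a_i^\vee}{a_i}a_{ij}$, $\langle\alpha_i,\Lambda_0\rangle=\delta_{i0}/a_0$, $\langle\Lambda_0,\Lambda_0\rangle=0$. Let $\mathring W=\langle s_1,\dots,s_n\rangle$ be the finite Weyl group acting on $\mathfrak h^*$, let $\mathring{\mathfrak h}^*$ (resp.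 $\mathring{\mathfrak h}^*_{\mathbb R}$) be the complex (resp. real) span of $\alpha_1,\dots,\alpha_n$, and let $\theta=\delta-a_0\alpha_0$. Put $$t_\alpha(\Lambda)=\Lambda+\Lambda(c)\,\alpha-\Big(\langle\Lambda,\alpha\rangle+\tfrac{\langle\alpha,\alpha\rangle}{2}\Lambda(c)\Big)\delta\qquad(\alpha\in\mathring{\mathfrak h}^*,\ \Lambda\in\mathfrak h^*),$$ let $M$ be the lattice generated by the elements $w(\theta/a_0)$, $w\in\mathring W$, let $\bar C=\{x\in\mathring{\mathfrak h}^*_{\mathbb R}: x(\alpha_i^\vee)\ge 0,\ 1\le i\le n\}$ be the closed fundamental Weyl chamber, and let $M^+=M\cap\bar C$. Let $$\mathring P^+=\{x\in\mathring{\mathfrak h}^*: x(\alpha_i^\vee)\in\mathbb Z_{\ge0},\ 1\le i\le n\},\qquad P^+=\{\Lambda\in\mathfrak h^*:\Lambda(\alpha_i^\vee)\in\mathbb Z_{\ge0},\ 0\le i\le n\}$$ be the sets of dominant integral weights. Then for every integer $\ell\ge1$ and every $\lambda\in\mathring P^+$ there exist $\mu\in M^+$ and $w\in\mathring W$ such that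 $$w\,t_\mu(\ell\Lambda_0-\lambda)\in P^+ .$$ -/

import Mathlib

open scoped Matrix

/-- An indecomposable generalized Cartan matrix of affine type, with rows and columns indexed by
`0, …, n`, together with its numerical labels and with a normalized choice of the vertex `0`.

Such a matrix is the same thing as an affine Lie algebra (untwisted or twisted) with the
vertices of its Dynkin diagram numbered so that `0` is the affine vertex.

* A generalized Cartan matrix is of affine type iff it has a strictly positive null vector;
  `mark` is the one with coprime natural entries (the labels `a_i`).  The transpose is then of
  affine type too, and `comark` is the same vector for it (the dual labels `a_i^∨`).  Both
  exist and are unique for every affine matrix, so they add nothing to the matrix.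
* `comark_zero` and `mark_zero_le` say that `0` is, up to an automorphism of the diagram, the
  vertex numbered `0` in Kac's tables Aff 1 – 3.  There `a_0^∨ = 1` always, `a_0 = 1` in every
  type except `A_{2n}^{(2)}`, and `a_0 = 2` in type `A_{2n}^{(2)}`, where the vertex `0` is
  the only one with dual label `1`. -/
structure AffineCartanMatrix (n : ℕ) where
  /-- The entries `a_{ij} = α_j(α_i^∨)`. -/
  A : Matrix (Fin (n + 1)) (Fin (n + 1)) ℤ
  diag : ∀ i, A i i = 2
  offDiag_nonpos : ∀ i j, i ≠ j → A i j ≤ 0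
  zero_symm : ∀ i j, A i j = 0 → A j i = 0
  indecomposable : ∀ S : Set (Fin (n + 1)), S.Nonempty → Sᶜ.Nonempty →
    ∃ i ∈ S, ∃ j ∈ Sᶜ, A i j ≠ 0
  /-- The labels `a_i`. -/
  mark : Fin (n + 1) → ℕ
  mark_pos : ∀ i, 0 < mark i
  mark_null : A *ᵥ (fun i => (mark i : ℤ)) = 0
  mark_coprime : Finset.univ.gcd mark = 1
  /-- The dual labels `a_i^∨`. -/
  comark : Fin (n + 1) → ℕ
  comark_pos : ∀ i, 0 < comark i
  comark_null : Aᵀ *ᵥ (fun i => (comark i : ℤ)) = 0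
  comark_coprime : Finset.univ.gcd comark = 1
  comark_zero : comark 0 = 1
  mark_zero_le : ∀ i, comark i = 1 → mark 0 ≤ mark i

namespace AffineCartanMatrix

noncomputable section

variable {n : ℕ} (X : AffineCartanMatrix n)

/-- The dual `𝔥^*` of the Cartan subalgebra of the affine Lie algebra, in its basis
`α_0, …, α_n, Λ_0`: the pair `(x, k)` stands for `x_0 α_0 + ⋯ + x_n α_n + k Λ_0`.
The Cartan subalgebra `𝔥` itself is the dual space of `𝔥^*`. -/
abbrev DualCartan (_X : AffineCartanMatrix n) : Type := (Fin (n + 1) → ℂ) × ℂ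

/-- The simple root `α_i`. -/
def simpleRoot (i : Fin (n + 1)) : X.DualCartan := (Pi.single i 1, 0)

/-- The fundamental weight `Λ_0`. -/
def fundWeightZero : X.DualCartan := (0, 1)

/-- The simple coroot `α_i^∨`, as a linear form on `𝔥^*`:
`α_j(α_i^∨) = a_{ij}` and `Λ_0(α_i^∨) = δ_{i0}`. -/
def simpleCoroot (i : Fin (n + 1)) : Module.Dual ℂ X.DualCartan where
  toFun Λ := ∑ j, (X.A i j : ℂ) * Λ.1 j + if i = 0 then Λ.2 else 0
  map_add' Λ Λ' := by
    split_ifs <;> simp [mul_add, Finset.sum_add_distrib] <;> ring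
  map_smul' r Λ := by
    split_ifs <;> simp [mul_add, Finset.mul_sum, mul_left_comm]

theorem simpleCoroot_simpleRoot (i j : Fin (n + 1)) :
    X.simpleCoroot i (X.simpleRoot j) = X.A i j := by
  simp [simpleCoroot, simpleRoot, Pi.single_apply]

theorem simpleCoroot_simpleRoot_self (i : Fin (n + 1)) :
    X.simpleCoroot i (X.simpleRoot i) = 2 := by
  simp [simpleCoroot_simpleRoot, X.diag]

/-- The canonical central element `c = ∑ a_i^∨ α_i^∨`. -/
def canonicalCentral : Module.Dual ℂ X.DualCartan :=
  ∑ i, (X.comark i : ℂ) • X.simpleCoroot i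

/-- The indivisible positive imaginary root `δ = ∑ a_i α_i`. -/
def imagRoot : X.DualCartan := ∑ i, (X.mark i : ℂ) • X.simpleRoot i

/-- The normalized invariant form on `𝔥^*`: `⟨α_i, α_j⟩ = (a_i^∨ / a_i) a_{ij}`,
`⟨α_0, Λ_0⟩ = 1 / a_0`, `⟨α_i, Λ_0⟩ = 0` for `i ≠ 0`, `⟨Λ_0, Λ_0⟩ = 0`. -/
def form (x y : X.DualCartan) : ℂ :=
  ∑ i, ∑ j, ((X.comark i : ℂ) / X.mark i) * X.A i j * x.1 i * y.1 j
    + (x.1 0 * y.2 + x.2 * y.1 0) / X.mark 0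

/-- The map `t_α(Λ) = Λ + Λ(c) α - (⟨Λ, α⟩ + (⟨α, α⟩ / 2) Λ(c)) δ`. -/
def translation (α Λ : X.DualCartan) : X.DualCartan :=
  Λ + X.canonicalCentral Λ • α
    - (X.form Λ α + X.form α α / 2 * X.canonicalCentral Λ) • X.imagRoot

/-- The simple reflection `s_i(Λ) = Λ - Λ(α_i^∨) α_i` on `𝔥^*`. -/
def simpleReflection (i : Fin (n + 1)) : X.DualCartan ≃ₗ[ℂ] X.DualCartan :=
  Module.reflection (X.simpleCoroot_simpleRoot_self i)

/-- The finite Weyl group, generated by `s_1, …, s_n` and acting on `𝔥^*`. -/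
def finiteWeylGroup : Subgroup (X.DualCartan ≃ₗ[ℂ] X.DualCartan) :=
  Subgroup.closure {s | ∃ i, i ≠ 0 ∧ s = X.simpleReflection i}

/-- The dual of the Cartan subalgebra of the finite-dimensional simple Lie algebra obtained by
dropping the vertex `0`, as the subspace of `𝔥^*` spanned by `α_1, …, α_n`. -/
def finiteDual : Submodule ℂ X.DualCartan :=
  Submodule.span ℂ {x | ∃ i, i ≠ 0 ∧ x = X.simpleRoot i}

/-- The real form of `finiteDual`: the real span of `α_1, …, α_n`. -/
def finiteDualReal : Submodule ℝ X.DualCartan :=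
  Submodule.span ℝ {x | ∃ i, i ≠ 0 ∧ x = X.simpleRoot i}

/-- `θ = δ - a_0 α_0 = a_1 α_1 + ⋯ + a_n α_n`. -/
def theta : X.DualCartan := X.imagRoot - (X.mark 0 : ℂ) • X.simpleRoot 0

/-- The translation lattice `M`, generated by the elements `w(θ / a_0)` with `w` in the finite
Weyl group. -/
def translationLattice : AddSubgroup X.DualCartan :=
  AddSubgroup.closure {x | ∃ w ∈ X.finiteWeylGroup, x = w ((X.mark 0 : ℂ)⁻¹ • X.theta)}

/-- The closed fundamental Weyl chamber of the finite root system.  The numbers `x(α_i^∨)` are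
real for `x` in the real form. -/
def closedChamber : Set X.DualCartan :=
  {x | x ∈ X.finiteDualReal ∧ ∀ i, i ≠ 0 → 0 ≤ (X.simpleCoroot i x).re}

/-- `M^+`, the intersection of the translation lattice with the closed chamber. -/
def dominantTranslations : Set X.DualCartan :=
  (X.translationLattice : Set X.DualCartan) ∩ X.closedChamber

/-- The dominant integral weights of the finite-dimensional simple Lie algebra. -/
def finiteDominantWeights : Set X.DualCartan :=
  {x | x ∈ X.finiteDual ∧ ∀ i, i ≠ 0 → ∃ m : ℕ, X.simpleCoroot i x = m}

/-- The dominant integral weights of the affine Lie algebra. -/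
def dominantWeights : Set X.DualCartan :=
  {Λ | ∀ i, ∃ m : ℕ, X.simpleCoroot i Λ = m}

end

end AffineCartanMatrix

/-!
Write `λ` for the given dominant weight and `δ` for the null root.  For `μ` in `M`, the weight
`t_μ(ℓ Λ_0 - λ)` equals `ℓ Λ_0 + (ℓ μ - λ)` up to a multiple of `δ`, and the finite Weyl group fixes
`Λ_0` and `δ`.  So the task is to find a dominant `μ ∈ M` for which some conjugate `z` of `ℓ μ - λ`
lies in the closed alcove of level `ℓ`: `z` dominant and `α_0^∨(z) ≥ -ℓ`.

Take for `μ` a point of `M` nearest to `λ / ℓ` for the invariant form.  Since `λ` is dominant,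
reflecting `μ` in a simple root on which it is negative does not increase the distance, so `μ` may be
chosen dominant (`exists_dominant_nearest`).  Then the origin is a nearest point of `ℓ M` to
`ℓ μ - λ`, and the same holds for its dominant conjugate `z`.  Comparing the distances of `z` to `0`
and to `ℓ θ / a_0` gives `2 ⟨z, θ / a_0⟩ ≤ ℓ ⟨θ / a_0, θ / a_0⟩`, and because `a_0^∨ = 1` this is
exactly `α_0^∨(z) ≥ -ℓ` (`exists_conjugate_mem_alcove`).  Integrality at `α_0^∨` follows from that at
the other coroots, again by `a_0^∨ = 1`.

Both choices need the form to be symmetric and positive definite on the span of `α_1, …, α_n`.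
Symmetry (`comark_mul_A_mul_mark_symm`) is proved without the classification of the affine diagrams.
Positivity comes from writing the form as a sum of squares over the edges of the diagram
(`realForm_self_eq_sum_sq`), which together with connectedness bounds the coordinates of vectors of
bounded length (`exists_coord_bound`) and makes the sets of lattice points in question finite.
Dominant elements of these sets are then found by maximizing the height (`exists_dominant`).
-/

namespace AffineCartanMatrix

/-! ### Symmetrizability -/

/-- A positive null vector of a generalized Cartan matrix is constant along the edges of any
subdiagram in which every vertex has at least two neighbours, and these edges are simple.  With
`p i j = -a_{ij} a_j / a_i`, the sum of `p i j` over a row is `2`, while `p i j + p j i ≥ 2` on every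
edge because `p i j * p j i` is a positive integer; counting edges forces equality. -/
theorem mul_null_vector_eq_neg_of_two_neighbors {ι : Type*} [Fintype ι] [DecidableEq ι]
    (A : Matrix ι ι ℤ)
    (diag : ∀ i, A i i = 2) (nonpos : ∀ i j, i ≠ j → A i j ≤ 0)
    (zsymm : ∀ i j, A i j = 0 → A j i = 0) (a : ι → ℕ) (apos : ∀ i, 0 < a i)
    (null : ∀ i, ∑ j, A i j * (a j : ℤ) = 0) (U : Finset ι)
    (hU : ∀ i ∈ U, ∃ j ∈ U, ∃ k ∈ U, j ≠ k ∧ i ≠ j ∧ i ≠ k ∧ A i j ≠ 0 ∧ A i k ≠ 0)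
    (i j : ι) (hi : i ∈ U) (hj : j ∈ U) (hij : i ≠ j) (hA : A i j ≠ 0) :
    A i j * (a j : ℤ) = -a i := by
  have apos' : ∀ i, (0 : ℝ) < a i := fun i => by exact_mod_cast apos i
  set p : ι → ι → ℝ := fun i j => if i = j then 0 else -(A i j : ℝ) * a j / a i with hp
  set e : ι → ι → ℝ := fun i j => if i ≠ j ∧ A i j ≠ 0 then 1 else 0 with he
  have e_symm : ∀ i j, e i j = e j i := by
    intro i j
    have h : (i ≠ j ∧ A i j ≠ 0) ↔ (j ≠ i ∧ A j i ≠ 0) :=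
      ⟨fun h => ⟨h.1.symm, fun h' => h.2 (zsymm _ _ h')⟩,
        fun h => ⟨h.1.symm, fun h' => h.2 (zsymm _ _ h')⟩⟩
    simp only [he, h]
  have p_nonneg : ∀ i j, 0 ≤ p i j := by
    intro i j
    simp only [hp]
    split_ifs with h
    · exact le_rfl
    · have : (A i j : ℝ) ≤ 0 := by exact_mod_cast nonpos i j h
      have h1 := apos' i
      have h2 := apos' j
      exact div_nonneg (mul_nonneg (by linarith) h2.le) h1.le
  have p_row : ∀ i, ∑ j, p i j = 2 := by
    intro i
    have h1 : ∑ j, (A i j : ℝ) * a j = 0 := by exact_mod_cast null i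
    have h2 : ∀ j, p i j = -((A i j : ℝ) * a j) / a i + if i = j then 2 else 0 := by
      intro j
      simp only [hp]
      split_ifs with h
      · subst h
        have := (apos' i).ne'
        rw [diag]
        field_simp
        norm_num
      · ring
    simp only [h2, Finset.sum_add_distrib, ← Finset.sum_div, Finset.sum_neg_distrib, h1]
    simp
  have p_prod : ∀ i j, i ≠ j → A i j ≠ 0 → 1 ≤ p i j * p j i := by
    intro i j h hA
    have hA' : A j i ≠ 0 := fun h' => hA (zsymm _ _ h')
    have h1 : 1 ≤ A i j * A j i := by
      have := lt_of_le_of_ne (nonpos i j h) hA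
      have := lt_of_le_of_ne (nonpos j i h.symm) hA'
      nlinarith
    have h2 : p i j * p j i = ((A i j * A j i : ℤ) : ℝ) := by
      have := (apos' i).ne'
      have := (apos' j).ne'
      simp only [hp, if_neg h, if_neg h.symm]
      push_cast
      field_simp
    rw [h2]
    exact_mod_cast h1
  have edge : ∀ i j, 0 ≤ p i j + p j i - 2 * e i j := by
    intro i j
    by_cases h : i ≠ j ∧ A i j ≠ 0
    · have := p_prod i j h.1 h.2
      simp only [he, if_pos h]
      nlinarith [p_nonneg i j, p_nonneg j i, sq_nonneg (p i j - p j i)]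
    · simp only [he, if_neg h]
      linarith [p_nonneg i j, p_nonneg j i]
  have e_row : ∀ i ∈ U, 2 ≤ ∑ j ∈ U, e i j := by
    intro i hi
    obtain ⟨j, hj, k, hk, hjk, hij, hik, h1, h2⟩ := hU i hi
    calc (2 : ℝ) = ∑ x ∈ {j, k}, e i x := by
          rw [Finset.sum_pair hjk]
          simp only [he, ne_eq, hij, not_false_eq_true, h1, and_self, if_true, hik, h2]
          norm_num
      _ ≤ _ := by
          refine Finset.sum_le_sum_of_subset_of_nonneg ?_ ?_
          · intro x hx
            simp only [Finset.mem_insert, Finset.mem_singleton] at hx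
            rcases hx with rfl | rfl <;> assumption
          · intro x _ _
            simp only [he]
            split_ifs <;> norm_num
  have p_le : ∑ i ∈ U, ∑ j ∈ U, p i j ≤ ∑ i ∈ U, (2 : ℝ) := by
    refine Finset.sum_le_sum fun i _ => ?_
    rw [← p_row i]
    exact Finset.sum_le_univ_sum_of_nonneg (p_nonneg i)
  have e_ge : ∑ i ∈ U, (2 : ℝ) ≤ ∑ i ∈ U, ∑ j ∈ U, e i j := Finset.sum_le_sum e_row
  have total : ∑ i ∈ U, ∑ j ∈ U, (p i j + p j i - 2 * e i j) = 0 := by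
    refine le_antisymm ?_ (Finset.sum_nonneg fun i _ => Finset.sum_nonneg fun j _ => edge i j)
    have h : ∑ i ∈ U, ∑ j ∈ U, p j i = ∑ i ∈ U, ∑ j ∈ U, p i j := Finset.sum_comm
    simp only [Finset.sum_add_distrib, Finset.sum_sub_distrib, ← Finset.mul_sum, h]
    linarith
  have zero : p i j + p j i - 2 * e i j = 0 := by
    have h := (Finset.sum_eq_zero_iff_of_nonneg
      (fun i _ => Finset.sum_nonneg fun j _ => edge i j)).1 total i hi
    exact (Finset.sum_eq_zero_iff_of_nonneg (fun j _ => edge i j)).1 h j hj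
  have e1 : e i j = 1 := by simp [he, hij, hA]
  have p1 : p i j = 1 := by
    have := p_prod i j hij hA
    have h2 : p j i = 2 - p i j := by linarith
    rw [h2] at this
    nlinarith [sq_nonneg (p i j - 1)]
  simp only [hp, if_neg hij] at p1
  have h0 := (apos' i).ne'
  field_simp at p1
  have : (A i j : ℝ) * a j = -a i := by linarith
  exact_mod_cast this

variable {n : ℕ} (X : AffineCartanMatrix n)

theorem sum_A_mul_mark (i : Fin (n + 1)) : ∑ j, X.A i j * (X.mark j : ℤ) = 0 := by
  simpa [Matrix.mulVec, dotProduct] using congrFun X.mark_null i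

theorem sum_comark_mul_A (j : Fin (n + 1)) : ∑ i, (X.comark i : ℤ) * X.A i j = 0 := by
  simpa [Matrix.mulVec, dotProduct, mul_comm] using congrFun X.comark_null j

/-- An affine Cartan matrix is symmetrizable, by the ratios of its labels.  The matrix
`B i j = a_i^∨ a_{ij} a_j` has zero row and column sums, so in the subdiagram `U` of the vertices
where `B - Bᵀ` has a nonzero row, every vertex has two neighbours.  On such a subdiagram
`a_{ij} = -1` and both label vectors are constant along the edges, so that `B` is symmetric there. -/
theorem comark_mul_A_mul_mark_symm (i j : Fin (n + 1)) :
    (X.comark i : ℤ) * X.A i j * X.mark j = X.comark j * X.A j i * X.mark i := by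
  classical
  set N : Fin (n + 1) → Fin (n + 1) → ℤ := fun i j =>
    (X.comark i : ℤ) * X.A i j * X.mark j - X.comark j * X.A j i * X.mark i with hN
  by_contra hne
  have hNij : N i j ≠ 0 := sub_ne_zero.2 hne
  have N_anti : ∀ i j, N i j = -N j i := fun i j => by simp only [hN]; ring
  have N_row : ∀ i, ∑ j, N i j = 0 := by
    intro i
    have h1 := X.sum_A_mul_mark i
    have h2 := X.sum_comark_mul_A i
    simp only [hN, Finset.sum_sub_distrib, mul_assoc, ← Finset.mul_sum]
    simp only [← mul_assoc, ← Finset.sum_mul, h1, h2]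
    simp
  have N_self : ∀ i, N i i = 0 := fun i => by simp [hN]
  have N_A : ∀ i j, N i j ≠ 0 → i ≠ j ∧ X.A i j ≠ 0 := by
    intro i j h
    refine ⟨?_, fun h0 => ?_⟩
    · rintro rfl
      exact h (N_self i)
    · apply h
      simp [hN, h0, X.zero_symm _ _ h0]
  set U : Finset (Fin (n + 1)) := Finset.univ.filter fun i => ∃ j, N i j ≠ 0 with hU
  have memU : ∀ i j, N i j ≠ 0 → i ∈ U ∧ j ∈ U := by
    intro i j h
    simp only [hU, Finset.mem_filter, Finset.mem_univ, true_and]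
    exact ⟨⟨j, h⟩, ⟨i, by rw [N_anti]; exact neg_ne_zero.2 h⟩⟩
  have two : ∀ i ∈ U, ∃ j ∈ U, ∃ k ∈ U, j ≠ k ∧ i ≠ j ∧ i ≠ k ∧ X.A i j ≠ 0 ∧ X.A i k ≠ 0 := by
    intro i hi
    obtain ⟨j, hj⟩ : ∃ j, N i j ≠ 0 := by simpa [hU] using hi
    obtain ⟨k, hk, hk0⟩ : ∃ k, k ≠ j ∧ N i k ≠ 0 := by
      by_contra! h
      have := N_row i
      rw [Finset.sum_eq_single j (fun k _ hk => h k hk) (by simp)] at this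
      exact hj this
    exact ⟨j, (memU i j hj).2, k, (memU i k hk0).2, hk.symm, (N_A i j hj).1, (N_A i k hk0).1,
      (N_A i j hj).2, (N_A i k hk0).2⟩
  obtain ⟨hiU, hjU⟩ := memU i j hNij
  obtain ⟨hij, hA⟩ := N_A i j hNij
  have hA' : X.A j i ≠ 0 := fun h => hA (X.zero_symm _ _ h)
  have r := mul_null_vector_eq_neg_of_two_neighbors X.A X.diag X.offDiag_nonpos X.zero_symm X.mark
    X.mark_pos X.sum_A_mul_mark U two
  have c := mul_null_vector_eq_neg_of_two_neighbors X.Aᵀ (fun i => X.diag i)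
    (fun i j h => X.offDiag_nonpos j i h.symm) (fun i j h => X.zero_symm j i h) X.comark
    X.comark_pos (fun i => by simpa [mul_comm] using X.sum_comark_mul_A i) U (fun i hi => by
      obtain ⟨j, hj, k, hk, h1, h2, h3, h4, h5⟩ := two i hi
      exact ⟨j, hj, k, hk, h1, h2, h3, fun h => h4 (X.zero_symm _ _ h),
        fun h => h5 (X.zero_symm _ _ h)⟩)
  have r1 := r i j hiU hjU hij hA
  have r2 := r j i hjU hiU hij.symm hA'
  have c1 := c i j hiU hjU hij hA'
  have c2 := c j i hjU hiU hij.symm hA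
  simp only [Matrix.transpose_apply] at c1 c2
  apply hne
  have hm : X.A i j * X.A j i = 1 := by
    have h := (Int.natCast_pos.2 (X.mark_pos i)).ne'
    apply mul_right_cancel₀ h
    rw [mul_assoc, r2]
    linarith
  have hneg := X.offDiag_nonpos i j hij
  have hA1 : X.A i j = -1 := by
    rcases Int.isUnit_iff.1 (IsUnit.of_mul_eq_one _ hm) with h | h <;> omega
  have hA2 : X.A j i = -1 := by
    rw [hA1] at hm
    linarith
  rw [hA1] at r1 c2
  rw [hA1, hA2]
  have : (X.mark i : ℤ) = X.mark j := by linarith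
  have h' : (X.comark i : ℤ) = X.comark j := by linarith
  rw [this, h']

/-! ### The invariant form on the real span of the simple roots -/

/-- The simple coroot `α_i^∨` on the real span of `α_0, …, α_n`, in coordinates. -/
def realCoroot (i : Fin (n + 1)) : Module.Dual ℝ (Fin (n + 1) → ℝ) where
  toFun x := ∑ j, (X.A i j : ℝ) * x j
  map_add' x y := by simp [mul_add, Finset.sum_add_distrib]
  map_smul' r x := by simp [Finset.mul_sum, mul_left_comm]

theorem realCoroot_apply (i : Fin (n + 1)) (x : Fin (n + 1) → ℝ) :
    X.realCoroot i x = ∑ j, (X.A i j : ℝ) * x j := rfl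

theorem realCoroot_single (i j : Fin (n + 1)) :
    X.realCoroot i (Pi.single j 1) = X.A i j := by
  simp [realCoroot_apply, Pi.single_apply]

theorem realCoroot_single_self (i : Fin (n + 1)) :
    X.realCoroot i (Pi.single i 1) = 2 := by
  simp [realCoroot_single, X.diag]

theorem realCoroot_mark (i : Fin (n + 1)) :
    X.realCoroot i (fun j => (X.mark j : ℝ)) = 0 := by
  rw [realCoroot_apply]
  exact_mod_cast X.sum_A_mul_mark i

theorem sum_comark_mul_realCoroot (x : Fin (n + 1) → ℝ) :
    ∑ i, (X.comark i : ℝ) * X.realCoroot i x = 0 := by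
  simp only [realCoroot_apply, Finset.mul_sum]
  rw [Finset.sum_comm]
  refine Finset.sum_eq_zero fun j _ => ?_
  have h : ∑ i, (X.comark i : ℝ) * X.A i j = 0 := by exact_mod_cast X.sum_comark_mul_A j
  simp only [← mul_assoc, ← Finset.sum_mul, h, zero_mul]

/-- The normalized invariant form on the real span of `α_0, …, α_n`, in coordinates. -/
noncomputable def realForm : LinearMap.BilinForm ℝ (Fin (n + 1) → ℝ) :=
  Matrix.toBilin' (Matrix.of fun i j => (X.comark i : ℝ) / X.mark i * X.A i j)

theorem realForm_apply (x y : Fin (n + 1) → ℝ) :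
    X.realForm x y = ∑ i, ∑ j, x i * ((X.comark i : ℝ) / X.mark i * X.A i j) * y j := by
  simp [realForm, Matrix.toBilin'_apply]

theorem mark_real_pos (i : Fin (n + 1)) : (0 : ℝ) < X.mark i := by exact_mod_cast X.mark_pos i

theorem realForm_symm (x y : Fin (n + 1) → ℝ) : X.realForm x y = X.realForm y x := by
  rw [realForm_apply, realForm_apply, Finset.sum_comm]
  refine Finset.sum_congr rfl fun i _ => Finset.sum_congr rfl fun j _ => ?_
  have h : (X.comark j : ℝ) * X.A j i * X.mark i = X.comark i * X.A i j * X.mark j := by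
    exact_mod_cast X.comark_mul_A_mul_mark_symm j i
  have hi := (X.mark_real_pos i).ne'
  have hj := (X.mark_real_pos j).ne'
  field_simp
  linear_combination x j * y i * h

theorem realForm_single (i : Fin (n + 1)) (x : Fin (n + 1) → ℝ) :
    X.realForm (Pi.single i 1) x = (X.comark i : ℝ) / X.mark i * X.realCoroot i x := by
  rw [realForm_apply, Finset.sum_eq_single i (by simp +contextual) (by simp),
    realCoroot_apply, Finset.mul_sum]
  simp [mul_assoc]

theorem realForm_mark (x : Fin (n + 1) → ℝ) :
    X.realForm x (fun j => (X.mark j : ℝ)) = 0 := by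
  rw [realForm_apply]
  refine Finset.sum_eq_zero fun i _ => ?_
  have h := X.realCoroot_mark i
  rw [realCoroot_apply] at h
  simp only [mul_assoc, ← Finset.mul_sum, h, mul_zero]

theorem realForm_self_eq_sum_sq (x : Fin (n + 1) → ℝ) :
    X.realForm x x = ∑ i, ∑ j, -((X.comark i : ℝ) * X.A i j * X.mark j) / 2 *
      (x i / X.mark i - x j / X.mark j) ^ 2 := by
  set b : Fin (n + 1) → Fin (n + 1) → ℝ := fun i j => (X.comark i : ℝ) * X.A i j * X.mark j
  have row : ∀ i, ∑ j, b i j = 0 := by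
    intro i
    have h : ∑ j, (X.A i j : ℝ) * X.mark j = 0 := by exact_mod_cast X.sum_A_mul_mark i
    simp only [b, mul_assoc, ← Finset.mul_sum, h, mul_zero]
  have col : ∀ j, ∑ i, b i j = 0 := by
    intro j
    have h : ∑ i, (X.comark i : ℝ) * X.A i j = 0 := by exact_mod_cast X.sum_comark_mul_A j
    simp only [b, ← Finset.sum_mul, h, zero_mul]
  have e : ∀ i j, -((X.comark i : ℝ) * X.A i j * X.mark j) / 2 *
      (x i / X.mark i - x j / X.mark j) ^ 2 =
      x i * ((X.comark i : ℝ) / X.mark i * X.A i j) * x j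
        - (x i / X.mark i) ^ 2 / 2 * b i j - b i j * ((x j / X.mark j) ^ 2 / 2) := by
    intro i j
    have hi := (X.mark_real_pos i).ne'
    have hj := (X.mark_real_pos j).ne'
    simp only [b]
    field_simp
    ring
  have c : ∑ i, ∑ j, b i j * ((x j / X.mark j) ^ 2 / 2) = 0 := by
    rw [Finset.sum_comm]
    simp only [← Finset.sum_mul, col, zero_mul, Finset.sum_const_zero]
  simp only [e, Finset.sum_sub_distrib, ← Finset.mul_sum, row, c, mul_zero,
    sub_zero, X.realForm_apply]

theorem sq_sub_le_realForm (i j : Fin (n + 1)) (x : Fin (n + 1) → ℝ) :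
    -((X.comark i : ℝ) * X.A i j * X.mark j) / 2 * (x i / X.mark i - x j / X.mark j) ^ 2
      ≤ X.realForm x x := by
  have nonneg : ∀ i j, 0 ≤ -((X.comark i : ℝ) * X.A i j * X.mark j) / 2 *
      (x i / X.mark i - x j / X.mark j) ^ 2 := by
    intro i j
    by_cases h : i = j
    · subst h
      simp
    · refine mul_nonneg ?_ (sq_nonneg _)
      have h1 : (X.A i j : ℝ) ≤ 0 := by exact_mod_cast X.offDiag_nonpos i j h
      have h2 := X.mark_real_pos j
      have h3 : (0 : ℝ) ≤ X.comark i := Nat.cast_nonneg _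
      nlinarith [mul_nonneg (mul_nonneg h3 (neg_nonneg.2 h1)) h2.le]
  rw [realForm_self_eq_sum_sq]
  exact (Finset.single_le_sum (fun j _ => nonneg i j) (Finset.mem_univ j)).trans
    (Finset.single_le_sum (f := fun i => ∑ j, -((X.comark i : ℝ) * X.A i j * X.mark j) / 2 *
      (x i / X.mark i - x j / X.mark j) ^ 2)
      (fun i _ => Finset.sum_nonneg fun j _ => nonneg i j) (Finset.mem_univ i))

/-- The form is positive definite on the span of `α_1, …, α_n`, in the quantitative form of a bound
on the coordinates.  The bound spreads from the vertex `0` along the edges of the diagram, which is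
connected. -/
theorem exists_coord_bound (R : ℝ) (i : Fin (n + 1)) :
    ∃ K : ℝ, ∀ x : Fin (n + 1) → ℝ, x 0 = 0 → X.realForm x x ≤ R → |x i| ≤ K := by
  set T : Set (Fin (n + 1)) := {i | ∃ K : ℝ, ∀ x : Fin (n + 1) → ℝ, x 0 = 0 →
    X.realForm x x ≤ R → |x i| ≤ K} with hT
  by_contra hi
  obtain ⟨i, ⟨K, hK⟩, j, hj, hA⟩ := X.indecomposable T
    ⟨0, 0, fun x hx _ => by simp [hx]⟩ ⟨i, hi⟩
  apply hj
  have hij : i ≠ j := by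
    rintro rfl
    exact hj ⟨K, hK⟩
  have mi := X.mark_real_pos i
  have mj := X.mark_real_pos j
  set d : ℝ := -((X.comark i : ℝ) * X.A i j * X.mark j) / 2 with hd
  have d_pos : 0 < d := by
    have h1 : (X.A i j : ℝ) < 0 := by
      exact_mod_cast lt_of_le_of_ne (X.offDiag_nonpos i j hij) hA
    have h3 : (0 : ℝ) < X.comark i := by exact_mod_cast X.comark_pos i
    have := mul_pos (mul_pos h3 (neg_pos.2 h1)) mj
    rw [hd]
    linarith
  refine ⟨X.mark j * (1 + R / d + K / X.mark i), fun x hx hR => ?_⟩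
  have h1 := X.sq_sub_le_realForm i j x
  have h2 : (x i / X.mark i - x j / X.mark j) ^ 2 ≤ R / d := by
    rw [le_div_iff₀ d_pos, mul_comm]
    exact h1.trans hR
  have h3 : |x i / X.mark i - x j / X.mark j| ≤ 1 + R / d := by
    rw [← sq_abs] at h2
    nlinarith [sq_nonneg (|x i / X.mark i - x j / X.mark j| - 1),
      abs_nonneg (x i / X.mark i - x j / X.mark j)]
  have h4 : |x i / X.mark i| ≤ K / X.mark i := by
    rw [abs_div, abs_of_pos mi]
    gcongr
    exact hK x hx hR
  have h5 : |x j / X.mark j| ≤ 1 + R / d + K / X.mark i := by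
    have := abs_sub_abs_le_abs_sub (x j / (X.mark j : ℝ)) (x i / X.mark i)
    rw [abs_sub_comm] at this
    linarith
  rw [abs_div, abs_of_pos mj, div_le_iff₀ mj] at h5
  linarith

theorem eq_zero_of_realForm_self_nonpos {x : Fin (n + 1) → ℝ} (h0 : x 0 = 0)
    (hx : X.realForm x x ≤ 0) : x = 0 := by
  funext i
  obtain ⟨K, hK⟩ := X.exists_coord_bound 0 i
  by_contra hne
  have hpos : 0 < |x i| := abs_pos.2 hne
  have h := hK (((|K| + 1) / |x i|) • x) (by simp [h0]) (by
    simp only [map_smul, LinearMap.smul_apply, smul_eq_mul]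
    have : 0 ≤ (|K| + 1) / |x i| := by positivity
    exact mul_nonpos_of_nonneg_of_nonpos this (mul_nonpos_of_nonneg_of_nonpos this hx))
  rw [Pi.smul_apply, smul_eq_mul, abs_mul, abs_of_nonneg (by positivity : 0 ≤ (|K| + 1) / |x i|),
    div_mul_cancel₀ _ hpos.ne'] at h
  linarith [le_abs_self K]

theorem eq_zero_of_realCoroot_eq_zero {x : Fin (n + 1) → ℝ} (h0 : x 0 = 0)
    (hx : ∀ i, i ≠ 0 → X.realCoroot i x = 0) : x = 0 := by
  refine X.eq_zero_of_realForm_self_nonpos h0 (le_of_eq ?_)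
  rw [realForm_apply]
  refine Finset.sum_eq_zero fun i _ => ?_
  by_cases hi : i = 0
  · simp [hi, h0]
  · have := hx i hi
    rw [realCoroot_apply] at this
    simp only [mul_assoc, ← Finset.mul_sum, this, mul_zero]

/-- A translate of a lattice contains only finitely many points of bounded length. -/
theorem finite_of_realForm_le {S : Set (Fin (n + 1) → ℝ)} {R N : ℝ} (hN : N ≠ 0)
    (y : Fin (n + 1) → ℝ) (h0 : ∀ x ∈ S, x 0 = 0) (hR : ∀ x ∈ S, X.realForm x x ≤ R)
    (hint : ∀ x ∈ S, ∀ j, ∃ k : ℤ, N * (x j - y j) = k) : S.Finite := by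
  choose K hK using X.exists_coord_bound R
  choose! k hk using hint
  have hfin : (Set.univ.pi fun j =>
      Set.Icc (-⌈|N| * (K j + |y j|)⌉) ⌈|N| * (K j + |y j|)⌉).Finite :=
    Set.Finite.pi fun j => Set.finite_Icc _ _
  refine Set.Finite.of_finite_image (f := k) (hfin.subset ?_) ?_
  · rintro _ ⟨x, hx, rfl⟩ j -
    rw [Set.mem_Icc, ← abs_le]
    have h : |((k x j : ℤ) : ℝ)| ≤ |N| * (K j + |y j|) := by
      rw [← hk x hx j, abs_mul]
      have h1 := hK j x (h0 x hx) (hR x hx)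
      have h2 := abs_sub (x j) (y j)
      exact mul_le_mul_of_nonneg_left (by linarith) (abs_nonneg N)
    exact_mod_cast h.trans (Int.le_ceil _)
  · intro x hx x' hx' h
    funext j
    have h1 := hk x hx j
    rw [h, ← hk x' hx' j] at h1
    linarith [mul_left_cancel₀ hN h1]

/-! ### Reflections and dominance -/

/-- The simple reflection `s_i` on the real span of `α_0, …, α_n`, in coordinates. -/
noncomputable def realReflection (i : Fin (n + 1)) : (Fin (n + 1) → ℝ) ≃ₗ[ℝ] (Fin (n + 1) → ℝ) :=
  Module.reflection (X.realCoroot_single_self i)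

theorem realReflection_apply (i : Fin (n + 1)) (x : Fin (n + 1) → ℝ) :
    X.realReflection i x = x - X.realCoroot i x • Pi.single i 1 :=
  Module.reflection_apply _ _

theorem realForm_realReflection (i : Fin (n + 1)) (x : Fin (n + 1) → ℝ) :
    X.realForm (X.realReflection i x) (X.realReflection i x) = X.realForm x x := by
  simp only [realReflection_apply, map_sub, map_smul, LinearMap.sub_apply, LinearMap.smul_apply,
    smul_eq_mul, X.realForm_symm x (Pi.single i 1), realForm_single, realCoroot_single_self]
  ring

theorem realReflection_apply_zero {i : Fin (n + 1)} (hi : i ≠ 0) (x : Fin (n + 1) → ℝ) :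
    X.realReflection i x 0 = x 0 := by
  simp [realReflection_apply, hi.symm]

/-- Reflecting in a simple root on which a vector is negative raises the sum of its coordinates, so
a point of maximal height in a finite set closed under such reflections is dominant. -/
theorem exists_dominant {S : Set (Fin (n + 1) → ℝ)} (hfin : S.Finite) (hne : S.Nonempty)
    (hS : ∀ x ∈ S, ∀ i, i ≠ 0 → X.realCoroot i x < 0 → X.realReflection i x ∈ S) :
    ∃ x ∈ S, ∀ i, i ≠ 0 → 0 ≤ X.realCoroot i x := by
  obtain ⟨x, hx, hmax⟩ := Set.exists_max_image S (fun x => ∑ j, x j) hfin hne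
  refine ⟨x, hx, fun i hi => ?_⟩
  by_contra! hneg
  have h := hmax _ (hS x hx i hi hneg)
  simp only [realReflection_apply, Pi.sub_apply, Pi.smul_apply, smul_eq_mul,
    Finset.sum_sub_distrib, ← Finset.mul_sum, Finset.sum_pi_single', Finset.mem_univ,
    if_true] at h
  linarith

/-! ### Real weights and the translation lattice -/

/-- The inclusion of the real span of `α_0, …, α_n` into `𝔥^*`. -/
noncomputable def ofRealCoords : (Fin (n + 1) → ℝ) →ₗ[ℝ] X.DualCartan where
  toFun x := (fun i => (x i : ℂ), 0)
  map_add' x y := by ext <;> simp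
  map_smul' r x := by ext <;> simp

theorem ofRealCoords_apply (x : Fin (n + 1) → ℝ) :
    X.ofRealCoords x = (fun i => (x i : ℂ), 0) := rfl

theorem simpleCoroot_apply (i : Fin (n + 1)) (Λ : X.DualCartan) :
    X.simpleCoroot i Λ = ∑ j, (X.A i j : ℂ) * Λ.1 j + if i = 0 then Λ.2 else 0 := rfl

theorem simpleCoroot_ofRealCoords (i : Fin (n + 1)) (x : Fin (n + 1) → ℝ) :
    X.simpleCoroot i (X.ofRealCoords x) = (X.realCoroot i x : ℂ) := by
  simp [simpleCoroot_apply, ofRealCoords_apply, realCoroot_apply]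

theorem simpleReflection_apply (i : Fin (n + 1)) (Λ : X.DualCartan) :
    X.simpleReflection i Λ = Λ - X.simpleCoroot i Λ • X.simpleRoot i :=
  Module.reflection_apply _ _

theorem simpleReflection_ofRealCoords (i : Fin (n + 1)) (x : Fin (n + 1) → ℝ) :
    X.simpleReflection i (X.ofRealCoords x) = X.ofRealCoords (X.realReflection i x) := by
  rw [simpleReflection_apply, simpleCoroot_ofRealCoords, realReflection_apply]
  ext j
  · simp only [ofRealCoords_apply, simpleRoot, Prod.fst_sub, Prod.smul_fst, Pi.sub_apply,
      Pi.smul_apply, smul_eq_mul, Pi.single_apply]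
    split_ifs <;> simp
  · simp [ofRealCoords_apply, simpleRoot]

theorem simpleReflection_mem {i : Fin (n + 1)} (hi : i ≠ 0) :
    X.simpleReflection i ∈ X.finiteWeylGroup :=
  Subgroup.subset_closure ⟨i, hi, rfl⟩

/-- A property preserved by the reflections `s_1, …, s_n` is preserved by the finite Weyl group. -/
theorem finiteWeylGroup_induction {P : X.DualCartan → Prop}
    (hP : ∀ i, i ≠ 0 → ∀ Λ, P Λ → P (X.simpleReflection i Λ))
    {w : X.DualCartan ≃ₗ[ℂ] X.DualCartan} (hw : w ∈ X.finiteWeylGroup) :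
    ∀ Λ, P Λ → P (w Λ) := by
  induction hw using Subgroup.closure_induction_left with
  | one => exact fun Λ h => h
  | mul_left s hs w _ ih =>
    obtain ⟨i, hi, rfl⟩ := hs
    exact fun Λ h => hP i hi _ (ih Λ h)
  | inv_mul_cancel s hs w _ ih =>
    obtain ⟨i, hi, rfl⟩ := hs
    intro Λ h
    have e : (X.simpleReflection i)⁻¹ = X.simpleReflection i := Module.reflection_symm _
    rw [e]
    exact hP i hi _ (ih Λ h)

theorem finiteWeylGroup_apply_eq_self {Λ : X.DualCartan}
    (hΛ : ∀ i, i ≠ 0 → X.simpleCoroot i Λ = 0)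
    {w : X.DualCartan ≃ₗ[ℂ] X.DualCartan} (hw : w ∈ X.finiteWeylGroup) : w Λ = Λ :=
  X.finiteWeylGroup_induction (P := fun Λ' => Λ' = Λ)
    (fun i hi Λ' h => by rw [h, simpleReflection_apply, hΛ i hi, zero_smul, sub_zero]) hw Λ rfl

theorem simpleCoroot_imagRoot (i : Fin (n + 1)) : X.simpleCoroot i X.imagRoot = 0 := by
  have h : ∑ j, (X.A i j : ℂ) * X.mark j = 0 := by exact_mod_cast X.sum_A_mul_mark i
  simp only [imagRoot, map_sum, map_smul, simpleCoroot_simpleRoot, smul_eq_mul]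
  simpa only [mul_comm] using h

theorem canonicalCentral_apply (Λ : X.DualCartan) : X.canonicalCentral Λ = Λ.2 := by
  have h : ∑ i, (X.comark i : ℂ) * ∑ j, (X.A i j : ℂ) * Λ.1 j = 0 := by
    simp only [Finset.mul_sum]
    rw [Finset.sum_comm]
    refine Finset.sum_eq_zero fun j _ => ?_
    have h : ∑ i, (X.comark i : ℂ) * X.A i j = 0 := by exact_mod_cast X.sum_comark_mul_A j
    simp only [← mul_assoc, ← Finset.sum_mul, h, zero_mul]
  simp only [canonicalCentral, LinearMap.sum_apply, LinearMap.smul_apply, smul_eq_mul,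
    simpleCoroot_apply, mul_add, Finset.sum_add_distrib, h]
  simp [X.comark_zero]

theorem finiteWeylGroup_apply_mem_translationLattice {w : X.DualCartan ≃ₗ[ℂ] X.DualCartan}
    (hw : w ∈ X.finiteWeylGroup) {m : X.DualCartan} (hm : m ∈ X.translationLattice) :
    w m ∈ X.translationLattice := by
  unfold translationLattice at hm
  induction hm using AddSubgroup.closure_induction with
  | mem m hm =>
    obtain ⟨u, hu, rfl⟩ := hm
    exact AddSubgroup.subset_closure ⟨w * u, mul_mem hw hu, rfl⟩
  | zero => simp
  | add m m' _ _ h h' => simpa using add_mem h h'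
  | neg m _ h => simpa using neg_mem h

/-- The vector `θ / a_0` in coordinates, written as `δ / a_0 - α_0`. -/
noncomputable def realTheta : Fin (n + 1) → ℝ :=
  (X.mark 0 : ℝ)⁻¹ • (fun i => (X.mark i : ℝ)) - Pi.single 0 1

theorem ofRealCoords_realTheta :
    X.ofRealCoords X.realTheta = (X.mark 0 : ℂ)⁻¹ • X.theta := by
  have h0 : (X.mark 0 : ℂ) ≠ 0 := by exact_mod_cast (X.mark_pos 0).ne'
  have h : X.imagRoot = (fun i => (X.mark i : ℂ), 0) := by
    ext j
    · simp [imagRoot, simpleRoot, Prod.fst_sum, Finset.sum_apply, Pi.single_apply]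
    · simp [imagRoot, simpleRoot, Prod.snd_sum]
  rw [theta, smul_sub, smul_smul, inv_mul_cancel₀ h0, one_smul, h]
  ext j
  · simp only [ofRealCoords_apply, realTheta, simpleRoot, Prod.fst_sub, Prod.smul_fst,
      Pi.sub_apply, Pi.smul_apply, smul_eq_mul, Pi.single_apply]
    split_ifs <;> simp
  · simp [ofRealCoords_apply, simpleRoot]

theorem ofRealCoords_realTheta_mem : X.ofRealCoords X.realTheta ∈ X.translationLattice :=
  AddSubgroup.subset_closure ⟨1, one_mem _, X.ofRealCoords_realTheta⟩

theorem realTheta_zero : X.realTheta 0 = 0 := by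
  simp [realTheta, inv_mul_cancel₀ (X.mark_real_pos 0).ne']

theorem realCoroot_realTheta (i : Fin (n + 1)) : X.realCoroot i X.realTheta = -X.A i 0 := by
  simp [realTheta, realCoroot_mark, realCoroot_single]

theorem realForm_realTheta (x : Fin (n + 1) → ℝ) :
    X.realForm x X.realTheta = -(X.realCoroot 0 x / X.mark 0) := by
  rw [realTheta, map_sub, map_smul, realForm_mark, X.realForm_symm, realForm_single, X.comark_zero]
  simp
  ring

/-- The vectors of the span of `α_1, …, α_n` that are integral on the coroots and whose coordinates
lie in `ℤ / a_0`.  They form a lattice which contains `M` and is stable under the finite Weyl group,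
and which is visibly discrete. -/
def scaledLattice : AddSubgroup (Fin (n + 1) → ℝ) where
  carrier := {x | x 0 = 0 ∧ (∀ j, ∃ k : ℤ, (X.mark 0 : ℝ) * x j = k) ∧
    ∀ i, i ≠ 0 → ∃ k : ℤ, X.realCoroot i x = k}
  zero_mem' := ⟨rfl, fun _ => ⟨0, by simp⟩, fun _ _ => ⟨0, by simp⟩⟩
  add_mem' := by
    rintro x y ⟨hx, hx1, hx2⟩ ⟨hy, hy1, hy2⟩
    refine ⟨by simp [hx, hy], fun j => ?_, fun i hi => ?_⟩
    · obtain ⟨k, hk⟩ := hx1 j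
      obtain ⟨l, hl⟩ := hy1 j
      exact ⟨k + l, by simp [mul_add, hk, hl]⟩
    · obtain ⟨k, hk⟩ := hx2 i hi
      obtain ⟨l, hl⟩ := hy2 i hi
      exact ⟨k + l, by simp [hk, hl]⟩
  neg_mem' := by
    rintro x ⟨hx, hx1, hx2⟩
    refine ⟨by simp [hx], fun j => ?_, fun i hi => ?_⟩
    · obtain ⟨k, hk⟩ := hx1 j
      exact ⟨-k, by simp [hk]⟩
    · obtain ⟨k, hk⟩ := hx2 i hi
      exact ⟨-k, by simp [hk]⟩

theorem exists_realCoroot_realReflection {x : Fin (n + 1) → ℝ}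
    (hx : ∀ i, i ≠ 0 → ∃ k : ℤ, X.realCoroot i x = k) {i : Fin (n + 1)} (hi : i ≠ 0)
    (j : Fin (n + 1)) (hj : j ≠ 0) :
    ∃ k : ℤ, X.realCoroot j (X.realReflection i x) = k := by
  obtain ⟨k, hk⟩ := hx i hi
  obtain ⟨l, hl⟩ := hx j hj
  exact ⟨l - k * X.A j i, by simp [realReflection_apply, realCoroot_single, hk, hl]⟩

theorem realReflection_mem_scaledLattice {i : Fin (n + 1)} (hi : i ≠ 0) {x : Fin (n + 1) → ℝ}
    (hx : x ∈ X.scaledLattice) : X.realReflection i x ∈ X.scaledLattice := by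
  obtain ⟨h0, h1, h2⟩ := hx
  refine ⟨by rw [X.realReflection_apply_zero hi, h0], fun j => ?_,
    X.exists_realCoroot_realReflection h2 hi⟩
  obtain ⟨k, hk⟩ := h2 i hi
  obtain ⟨l, hl⟩ := h1 j
  refine ⟨l - X.mark 0 * (k * if j = i then 1 else 0), ?_⟩
  simp only [realReflection_apply, hk, Pi.sub_apply, Pi.smul_apply, smul_eq_mul, mul_sub, hl,
    Pi.single_apply]
  push_cast
  rfl

theorem realTheta_mem_scaledLattice : X.realTheta ∈ X.scaledLattice := by
  refine ⟨X.realTheta_zero, fun j => ?_, fun i _ => ⟨-X.A i 0, by simp [realCoroot_realTheta]⟩⟩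
  refine ⟨X.mark j - X.mark 0 * if j = 0 then 1 else 0, ?_⟩
  have := (X.mark_real_pos 0).ne'
  simp only [realTheta, Pi.sub_apply, Pi.smul_apply, smul_eq_mul, mul_sub, Pi.single_apply,
    mul_inv_cancel_left₀ this]
  push_cast
  rfl

theorem exists_scaledLattice_of_mem_translationLattice {m : X.DualCartan}
    (hm : m ∈ X.translationLattice) : ∃ x ∈ X.scaledLattice, X.ofRealCoords x = m := by
  suffices h : X.translationLattice ≤ X.scaledLattice.map X.ofRealCoords.toAddMonoidHom from h hm
  rw [translationLattice, AddSubgroup.closure_le]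
  rintro _ ⟨w, hw, rfl⟩
  refine X.finiteWeylGroup_induction
    (P := fun Λ => Λ ∈ X.scaledLattice.map X.ofRealCoords.toAddMonoidHom) ?_ hw _
    ⟨X.realTheta, X.realTheta_mem_scaledLattice, X.ofRealCoords_realTheta⟩
  rintro i hi _ ⟨x, hx, rfl⟩
  exact ⟨X.realReflection i x, X.realReflection_mem_scaledLattice hi hx,
    (X.simpleReflection_ofRealCoords i x).symm⟩

theorem ofRealCoords_injective : Function.Injective X.ofRealCoords := by
  intro x y h
  funext j
  have := congrFun (congrArg Prod.fst h) j
  simpa [ofRealCoords_apply] using this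

/-- The translation lattice `M` in real coordinates. -/
noncomputable def realLattice : AddSubgroup (Fin (n + 1) → ℝ) :=
  X.translationLattice.comap X.ofRealCoords.toAddMonoidHom

theorem mem_realLattice {x : Fin (n + 1) → ℝ} :
    x ∈ X.realLattice ↔ X.ofRealCoords x ∈ X.translationLattice := Iff.rfl

theorem realLattice_le_scaledLattice : X.realLattice ≤ X.scaledLattice := by
  intro x hx
  obtain ⟨y, hy, h⟩ := X.exists_scaledLattice_of_mem_translationLattice hx
  rwa [← X.ofRealCoords_injective h]

theorem realReflection_mem_realLattice {i : Fin (n + 1)} (hi : i ≠ 0) {x : Fin (n + 1) → ℝ}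
    (hx : x ∈ X.realLattice) : X.realReflection i x ∈ X.realLattice := by
  rw [mem_realLattice, ← simpleReflection_ofRealCoords]
  exact X.finiteWeylGroup_apply_mem_translationLattice (X.simpleReflection_mem hi) hx

theorem ofRealCoords_mem_finiteDualReal {x : Fin (n + 1) → ℝ} (hx : x 0 = 0) :
    X.ofRealCoords x ∈ X.finiteDualReal := by
  have h : X.ofRealCoords x = ∑ i, x i • X.simpleRoot i := by
    ext j
    · simp [ofRealCoords_apply, simpleRoot, Prod.fst_sum, Finset.sum_apply, Pi.single_apply]
    · simp [ofRealCoords_apply, simpleRoot, Prod.snd_sum]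
  rw [h]
  refine Submodule.sum_mem _ fun i _ => ?_
  by_cases hi : i = 0
  · simp [hi, hx]
  · exact Submodule.smul_mem _ _ (Submodule.subset_span ⟨i, hi, rfl⟩)

/-- An element of the complex span of `α_1, …, α_n` with integral values on the coroots has real
coordinates: its imaginary part is killed by all `α_i^∨`, `i ≠ 0`. -/
theorem exists_ofRealCoords_of_mem_finiteDominantWeights {lam : X.DualCartan}
    (h : lam ∈ X.finiteDominantWeights) :
    ∃ y, X.ofRealCoords y = lam ∧ y 0 = 0 ∧
      ∀ i, i ≠ 0 → ∃ m : ℕ, X.realCoroot i y = m := by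
  obtain ⟨hspan, hint⟩ := h
  have hz : lam.1 0 = 0 ∧ lam.2 = 0 := by
    have : X.finiteDual ≤ LinearMap.ker ((LinearMap.proj 0).comp (LinearMap.fst ℂ _ _)) ⊓
        LinearMap.ker (LinearMap.snd ℂ (Fin (n + 1) → ℂ) ℂ) := by
      rw [finiteDual, Submodule.span_le]
      rintro _ ⟨i, hi, rfl⟩
      simp [simpleRoot, hi.symm]
    simpa using this hspan
  have coroot : ∀ i, i ≠ 0 → X.simpleCoroot i lam = ∑ j, (X.A i j : ℂ) * lam.1 j := by
    intro i hi
    simp [simpleCoroot_apply, hi]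
  have him : (fun j => (lam.1 j).im) = 0 := by
    refine X.eq_zero_of_realCoroot_eq_zero (by simp [hz.1]) fun i hi => ?_
    obtain ⟨m, hm⟩ := hint i hi
    rw [coroot i hi] at hm
    simpa [realCoroot_apply] using congrArg Complex.im hm
  refine ⟨fun j => (lam.1 j).re, ?_, by simp [hz.1], fun i hi => ?_⟩
  · ext j
    · exact Complex.ext rfl (congrFun him j).symm
    · exact hz.2.symm
  · obtain ⟨m, hm⟩ := hint i hi
    rw [coroot i hi] at hm
    exact ⟨m, by simpa [realCoroot_apply] using congrArg Complex.re hm⟩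

/-! ### The nearest lattice point -/

/-- Among the lattice points nearest to a dominant `y / ℓ`, one is dominant: reflecting a point in
a simple root on which it is negative does not increase its distance from a dominant vector. -/
theorem exists_dominant_nearest {ℓ : ℝ} (hℓ : 0 < ℓ) {y : Fin (n + 1) → ℝ} (y0 : y 0 = 0)
    (hy : ∀ i, i ≠ 0 → 0 ≤ X.realCoroot i y) :
    ∃ μ ∈ X.realLattice, (∀ i, i ≠ 0 → 0 ≤ X.realCoroot i μ) ∧
      ∀ ν ∈ X.realLattice,
        X.realForm (ℓ • μ - y) (ℓ • μ - y) ≤ X.realForm (ℓ • ν - y) (ℓ • ν - y) := by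
  set d : (Fin (n + 1) → ℝ) → ℝ := fun μ => X.realForm (ℓ • μ - y) (ℓ • μ - y) with hd
  have fin : ∀ R, {μ | μ ∈ X.realLattice ∧ d μ ≤ R}.Finite := by
    intro R
    have h : ((fun μ => ℓ • μ - y) '' {μ | μ ∈ X.realLattice ∧ d μ ≤ R}).Finite := by
      refine X.finite_of_realForm_le (R := R) (N := X.mark 0 / ℓ)
        (div_ne_zero (X.mark_real_pos 0).ne' hℓ.ne') (-y) ?_ ?_ ?_
      · rintro _ ⟨μ, ⟨hμ, -⟩, rfl⟩
        simp [y0, (X.realLattice_le_scaledLattice hμ).1]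
      · rintro _ ⟨μ, ⟨-, hμ⟩, rfl⟩
        exact hμ
      · rintro _ ⟨μ, ⟨hμ, -⟩, rfl⟩ j
        obtain ⟨k, hk⟩ := (X.realLattice_le_scaledLattice hμ).2.1 j
        refine ⟨k, ?_⟩
        rw [← hk]
        simp only [Pi.sub_apply, Pi.smul_apply, Pi.neg_apply, smul_eq_mul]
        field_simp
        ring
    refine h.of_finite_image fun μ _ ν _ h => ?_
    exact smul_right_injective _ hℓ.ne' (sub_left_injective h)
  obtain ⟨μ₀, ⟨hμ₀, hμ₀d⟩, hmin⟩ := Set.exists_min_image _ d (fin (d 0))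
    ⟨0, zero_mem _, le_rfl⟩
  have hmin' : ∀ ν ∈ X.realLattice, d μ₀ ≤ d ν := by
    intro ν hν
    rcases le_total (d ν) (d 0) with h | h
    · exact hmin ν ⟨hν, h⟩
    · exact hμ₀d.trans h
  obtain ⟨μ, ⟨hμ, hμd⟩, hdom⟩ := X.exists_dominant (fin (d μ₀)) ⟨μ₀, hμ₀, le_rfl⟩ (by
    rintro μ ⟨hμ, hμd⟩ i hi hneg
    refine ⟨X.realReflection_mem_realLattice hi hμ, le_trans ?_ hμd⟩
    have h1 := hy i hi
    have hm := X.mark_real_pos i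
    have h2 : (0 : ℝ) ≤ X.comark i / X.mark i := by positivity
    have h3 : d (X.realReflection i μ) = d μ + 2 * ℓ *
        (X.realCoroot i μ * (X.comark i / X.mark i * X.realCoroot i y)) := by
      simp only [hd, realReflection_apply, map_sub, map_smul, LinearMap.sub_apply,
        LinearMap.smul_apply, smul_eq_mul, X.realForm_symm μ (Pi.single i 1),
        X.realForm_symm y (Pi.single i 1), realForm_single, realCoroot_single_self]
      ring
    rw [h3]
    have h4 := mul_nonpos_of_nonpos_of_nonneg hneg.le (mul_nonneg h2 h1)
    have h5 := mul_nonpos_of_nonneg_of_nonpos (by positivity : 0 ≤ 2 * ℓ) h4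
    linarith)
  exact ⟨μ, hμ, hdom, fun ν hν => hμd.trans (hmin' ν hν)⟩

/-- An integral vector `v` for which the origin is a nearest point of `ℓ M` has a conjugate in the
closed alcove of level `ℓ`.  The inequality at `α_0^∨` compares the distances from `0` and
`ℓ θ / a_0`. -/
theorem exists_conjugate_mem_alcove {ℓ : ℝ} (hℓ : 0 < ℓ) {v : Fin (n + 1) → ℝ} (v0 : v 0 = 0)
    (hint : ∀ i, i ≠ 0 → ∃ k : ℤ, X.realCoroot i v = k)
    (hnear : ∀ ν ∈ X.realLattice, X.realForm v v ≤ X.realForm (v - ℓ • ν) (v - ℓ • ν)) :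
    ∃ w ∈ X.finiteWeylGroup, ∃ z, w (X.ofRealCoords v) = X.ofRealCoords z ∧
      (∀ i, i ≠ 0 → ∃ m : ℕ, X.realCoroot i z = m) ∧ -ℓ ≤ X.realCoroot 0 z := by
  set S : Set (Fin (n + 1) → ℝ) := {z | z 0 = 0 ∧
    (∃ w ∈ X.finiteWeylGroup, w (X.ofRealCoords v) = X.ofRealCoords z) ∧
    X.realForm z z ≤ X.realForm v v ∧ (∀ j, ∃ k : ℤ, 1 * (z j - v j) = k) ∧
    (∀ i, i ≠ 0 → ∃ k : ℤ, X.realCoroot i z = k) ∧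
    ∀ ν ∈ X.realLattice, X.realForm z z ≤ X.realForm (z - ℓ • ν) (z - ℓ • ν)} with hS
  have fin : S.Finite := X.finite_of_realForm_le one_ne_zero v (fun z hz => hz.1)
    (fun z hz => hz.2.2.1) (fun z hz => hz.2.2.2.1)
  obtain ⟨z, ⟨-, ⟨w, hw, hwz⟩, -, -, hzint, hznear⟩, hdom⟩ := X.exists_dominant fin
    ⟨v, v0, ⟨1, one_mem _, rfl⟩, le_rfl, fun j => ⟨0, by simp⟩, hint, hnear⟩ (by
    rintro z ⟨z0, ⟨w, hw, hwz⟩, hzv, hcoord, hzint, hznear⟩ i hi -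
    refine ⟨by rw [X.realReflection_apply_zero hi, z0],
      ⟨X.simpleReflection i * w, mul_mem (X.simpleReflection_mem hi) hw, ?_⟩,
      by rwa [realForm_realReflection], fun j => ?_, X.exists_realCoroot_realReflection hzint hi,
      fun ν hν => ?_⟩
    · rw [LinearEquiv.mul_apply, hwz, simpleReflection_ofRealCoords]
    · obtain ⟨k, hk⟩ := hcoord j
      obtain ⟨l, hl⟩ := hzint i hi
      refine ⟨k - l * if j = i then 1 else 0, ?_⟩
      push_cast
      rw [← hk, ← hl]
      simp only [realReflection_apply, Pi.sub_apply, Pi.smul_apply, smul_eq_mul, Pi.single_apply]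
      ring
    · rw [realForm_realReflection]
      refine (hznear _ (X.realReflection_mem_realLattice hi hν)).trans (le_of_eq ?_)
      rw [← X.realForm_realReflection i, map_sub, map_smul]
      congr 4 <;> exact Module.involutive_reflection _ _)
  refine ⟨w, hw, z, hwz, fun i hi => ?_, ?_⟩
  · obtain ⟨k, hk⟩ := hzint i hi
    have h := hdom i hi
    rw [hk] at h
    lift k to ℕ using (by exact_mod_cast h)
    exact ⟨k, by simpa using hk⟩
  · have h := hznear X.realTheta X.ofRealCoords_realTheta_mem
    have hm := X.mark_real_pos 0
    simp only [map_sub, map_smul, LinearMap.sub_apply, LinearMap.smul_apply, smul_eq_mul,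
      X.realForm_symm X.realTheta z, realForm_realTheta, realCoroot_realTheta, X.diag] at h
    field_simp at h
    push_cast at h
    nlinarith

end AffineCartanMatrix

open AffineCartanMatrix

theorem proposition3p1 {n : ℕ} (X : AffineCartanMatrix n) (ℓ : ℕ) (hℓ : 0 < ℓ)
    (lam : X.DualCartan) (hlam : lam ∈ X.finiteDominantWeights) :
    ∃ μ ∈ X.dominantTranslations, ∃ w ∈ X.finiteWeylGroup,
      w (X.translation μ ((ℓ : ℂ) • X.fundWeightZero - lam)) ∈ X.dominantWeights := by
  have hℓ' : (0 : ℝ) < ℓ := by exact_mod_cast hℓ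
  obtain ⟨y, rfl, y0, hy⟩ := X.exists_ofRealCoords_of_mem_finiteDominantWeights hlam
  obtain ⟨μ, hμ, hdom, hnear⟩ := X.exists_dominant_nearest hℓ' y0 (fun i hi => by
    obtain ⟨m, hm⟩ := hy i hi
    rw [hm]
    exact Nat.cast_nonneg m)
  have hμ' := X.realLattice_le_scaledLattice hμ
  obtain ⟨w, hw, z, hwz, hz, hz0⟩ := X.exists_conjugate_mem_alcove hℓ' (v := (ℓ : ℝ) • μ - y)
    (by simp [hμ'.1, y0]) (fun i hi => by
      obtain ⟨m, hm⟩ := hy i hi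
      obtain ⟨k, hk⟩ := hμ'.2.2 i hi
      exact ⟨ℓ * k - m, by simp [hm, hk]⟩) (fun ν hν => by
      refine (hnear (μ - ν) (sub_mem hμ hν)).trans (le_of_eq ?_)
      rw [smul_sub, sub_right_comm])
  refine ⟨X.ofRealCoords μ, ⟨hμ, X.ofRealCoords_mem_finiteDualReal hμ'.1, fun i hi => ?_⟩,
    w, hw, ?_⟩
  · rw [simpleCoroot_ofRealCoords, Complex.ofReal_re]
    exact hdom i hi
  -- Modulo `δ` the translated weight is `ℓ Λ_0 + (ℓ μ - λ)`, and `w` fixes `Λ_0` and `δ`.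
  obtain ⟨t, ht⟩ : ∃ t : ℂ, X.translation (X.ofRealCoords μ)
      ((ℓ : ℂ) • X.fundWeightZero - X.ofRealCoords y) =
      (ℓ : ℂ) • X.fundWeightZero + X.ofRealCoords ((ℓ : ℝ) • μ - y) - t • X.imagRoot := by
    have hc : X.canonicalCentral ((ℓ : ℂ) • X.fundWeightZero - X.ofRealCoords y) = ℓ := by
      simp [canonicalCentral_apply, fundWeightZero, ofRealCoords_apply]
    have hs : X.ofRealCoords ((ℓ : ℝ) • μ) = (ℓ : ℂ) • X.ofRealCoords μ := by
      ext <;> simp [ofRealCoords_apply]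
    set Λ := (ℓ : ℂ) • X.fundWeightZero - X.ofRealCoords y with hΛ
    refine ⟨X.form Λ (X.ofRealCoords μ) +
      X.form (X.ofRealCoords μ) (X.ofRealCoords μ) / 2 * ℓ, ?_⟩
    rw [translation, hc, hΛ, map_sub, hs]
    congr 1
    abel
  have hcoroot : ∀ i, X.simpleCoroot i (w (X.translation (X.ofRealCoords μ)
      ((ℓ : ℂ) • X.fundWeightZero - X.ofRealCoords y))) =
      (X.realCoroot i z : ℂ) + if i = 0 then (ℓ : ℂ) else 0 := by
    intro i
    have h1 : w X.imagRoot = X.imagRoot :=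
      X.finiteWeylGroup_apply_eq_self (fun i _ => X.simpleCoroot_imagRoot i) hw
    have h2 : w X.fundWeightZero = X.fundWeightZero :=
      X.finiteWeylGroup_apply_eq_self
        (fun i hi => by simp [simpleCoroot_apply, fundWeightZero, hi]) hw
    have h3 : X.simpleCoroot i X.fundWeightZero = if i = 0 then 1 else 0 := by
      simp [simpleCoroot_apply, fundWeightZero]
    rw [ht, map_sub, map_add, map_smul, map_smul, h1, h2, hwz, map_sub, map_add, map_smul,
      map_smul, h3, simpleCoroot_imagRoot, simpleCoroot_ofRealCoords]
    simp [add_comm]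
  intro i
  rw [hcoroot]
  by_cases hi : i = 0
  · subst hi
    -- `∑ a_i^∨ α_i^∨` vanishes on `z` and `a_0^∨ = 1`, so `α_0^∨` is integral on `z` as well.
    obtain ⟨k, hk⟩ : ∃ k : ℤ, X.realCoroot 0 z = k := by
      choose! m hm using hz
      refine ⟨-∑ i : Fin n, (X.comark i.succ : ℤ) * m i.succ, ?_⟩
      have h := X.sum_comark_mul_realCoroot z
      rw [Fin.sum_univ_succ, X.comark_zero] at h
      simp only [hm _ (Fin.succ_ne_zero _)] at h
      push_cast at h ⊢
      linarith
    rw [hk] at hz0 ⊢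
    have h : 0 ≤ k + ℓ := by
      have : (0 : ℝ) ≤ ((k + ℓ : ℤ) : ℝ) := by push_cast; linarith
      exact_mod_cast this
    lift k + ℓ to ℕ using h with m hm
    exact ⟨m, by simpa using (congrArg (Int.cast : ℤ → ℂ) hm).symm⟩
  · obtain ⟨m, hm⟩ := hz i hi
    exact ⟨m, by simp [hi, hm]⟩
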